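/- Let $q$ be a prime power and let $m\ge 2$ be an integer with $q\ge 2m-3$. Let $$G=\begin{pmatrix}\beta_{1,1}&\cdots&\beta_{1,m}\\ \beta_{2,1}&\cdots&\beta_{2,m}\end{pmatrix}\in\mathbb{F}_{q^m}^{2\times m}$$ be a matrix whose two rows are linearly independent over $\mathbb{F}_{q^m}$ and such that, for each $i\in\{1,2\}$, the entries $\beta_{i,1},\ldots,\beta_{i,m}$ of the $i$-th row are linearly independent over $\mathbb{F}_q$. Let $V\le\mathbb{F}_{q^m}^m$ be the row space of $G$ over $\mathbb{F}_{q^m}$. Then $$3m-2\le \mathrm{trk}(V)\le 4m-4 .$$ Here $\mathrm{trk}(V)$ is defined as follows. For an $\mathbb{F}_q$-basis $\Gamma=(\gamma_1,\ldots,\gamma_m)$ of $\mathbb{F}_{q^m}$ and $v\in\mathbb{F}_{q^m}^m$, let $\Gamma(v)\in\mathbb{F}_q^{m\times m}$ be the matrix whose $i$-th row is the coordinate vector of $v_i$ with respect to $\Gamma$, and let $\Gamma(V)$ be the $\mathbb{F}_q$-span of $\{\Gamma(v): v\in V\}$. The tensor rank of a 3-tensor $X\in\mathbb{F}_q^{k\times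 m\times m}$ is the least $R$ such that $X=\sum_{r=1}^R u_r\otimes v_r\otimes w_r$ with $u_r\in\mathbb{F}_q^k$ and $v_r,w_r\in\mathbb{F}_q^m$, and $\mathrm{trk}(V)$ is the tensor rank of any 3-tensor $X=(X_1\mid\cdots\mid X_k)$ with $k=\dim_{\mathbb{F}_q}\Gamma(V)$ whose slices $X_1,\ldots,X_k$ span $\Gamma(V)$. The bounds hold for every choice of the basis $\Gamma$. -/

import Mathlib

open scoped BigOperators

noncomputable section

namespace TensorRank

variable {𝕂 : Type*} [Field 𝕂]

/-- Coordinate 3-tensors in `𝕂^{k × n × m}`: arrays `X l i j`, equivalently `k`-tuples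
`(X_1 ∣ ⋯ ∣ X_k)` of `n × m` matrices. -/
abbrev Tensor3 (𝕂 : Type*) (k n m : ℕ) : Type _ := Fin k → Matrix (Fin n) (Fin m) 𝕂

/-- The simple tensor `u ⊗ v ⊗ w`, as an array. -/
def simpleTensor {k n m : ℕ} (u : Fin k → 𝕂) (v : Fin n → 𝕂) (w : Fin m → 𝕂) :
    Tensor3 𝕂 k n m :=
  fun l => Matrix.of fun i j => u l * v i * w j

/-- `X` is a sum of `R` simple tensors. -/
def IsSumOfSimple {k n m : ℕ} (X : Tensor3 𝕂 k n m) (R : ℕ) : Prop :=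
  ∃ (u : Fin R → Fin k → 𝕂) (v : Fin R → Fin n → 𝕂) (w : Fin R → Fin m → 𝕂),
    X = ∑ r : Fin R, simpleTensor (u r) (v r) (w r)

/-- The tensor rank of a 3-tensor: the least `R` such that `X` is a sum of `R` simple tensors. -/
def trk {k n m : ℕ} (X : Tensor3 𝕂 k n m) : ℕ :=
  sInf {R : ℕ | IsSumOfSimple X R}

/-- The first slice space: the span of the matrices `X_1, …, X_k`. -/
def ss₁ {k n m : ℕ} (X : Tensor3 𝕂 k n m) : Submodule 𝕂 (Matrix (Fin n) (Fin m) 𝕂) :=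
  Submodule.span 𝕂 (Set.range X)

/-- The tensor of a basis of `W`, an array with `dim W` slices. -/
def generatorTensor {n m : ℕ} (W : Submodule 𝕂 (Matrix (Fin n) (Fin m) 𝕂)) :
    Tensor3 𝕂 (Module.finrank 𝕂 W) n m :=
  fun l => (Module.finBasis 𝕂 W l : Matrix (Fin n) (Fin m) 𝕂)

/-- The tensor rank of a space of matrices: the tensor rank of a generator tensor. By
`trk_eq_trkSpace` below any generator tensor gives the same value. -/
def trkSpace {n m : ℕ} (W : Submodule 𝕂 (Matrix (Fin n) (Fin m) 𝕂)) : ℕ :=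
  trk (generatorTensor W)

/-- Every tensor is a sum of finitely many simple tensors, so `trk` is a true minimum. -/
theorem exists_isSumOfSimple {k n m : ℕ} (X : Tensor3 𝕂 k n m) : ∃ R, IsSumOfSimple X R := by
  classical
  let e := Fintype.equivFin (Fin k × Fin n × Fin m)
  refine ⟨Fintype.card (Fin k × Fin n × Fin m),
    fun r => Pi.single (e.symm r).1 (X (e.symm r).1 (e.symm r).2.1 (e.symm r).2.2),
    fun r => Pi.single (e.symm r).2.1 1, fun r => Pi.single (e.symm r).2.2 1, ?_⟩
  rw [Equiv.sum_comp e.symm (fun p : Fin k × Fin n × Fin m =>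
    simpleTensor (Pi.single p.1 (X p.1 p.2.1 p.2.2)) (Pi.single p.2.1 (1 : 𝕂))
      (Pi.single p.2.2 (1 : 𝕂)))]
  funext l
  ext i j
  simp [simpleTensor, Fintype.sum_prod_type, Finset.sum_apply, Matrix.sum_apply, Pi.single_apply]

theorem ss₁_generatorTensor {n m : ℕ} (W : Submodule 𝕂 (Matrix (Fin n) (Fin m) 𝕂)) :
    ss₁ (generatorTensor W) = W := by
  have h : Set.range (generatorTensor W) = W.subtype '' Set.range (Module.finBasis 𝕂 W) := by
    rw [← Set.range_comp]; rfl
  rw [ss₁, h, Submodule.span_image, Module.Basis.span_eq, Submodule.map_top,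
    Submodule.range_subtype]

theorem trk_le_of_ss₁_le {k k' n m : ℕ} (X : Tensor3 𝕂 k n m) (Y : Tensor3 𝕂 k' n m)
    (h : ss₁ X ≤ ss₁ Y) : trk X ≤ trk Y := by
  have hY : IsSumOfSimple Y (trk Y) := Nat.sInf_mem (exists_isSumOfSimple Y)
  obtain ⟨u, v, w, hu⟩ := hY
  have hc : ∀ l, ∃ c : Fin k' → 𝕂, ∑ p, c p • Y p = X l := fun l =>
    (Submodule.mem_span_range_iff_exists_fun 𝕂).1 (h (Submodule.subset_span ⟨l, rfl⟩))
  choose c hc using hc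
  refine Nat.sInf_le ⟨fun r l => ∑ p, c l p * u r p, v, w, ?_⟩
  funext l
  rw [← hc l]
  ext i j
  have hY' : ∀ p, Y p i j = ∑ r, u r p * v r i * w r j := fun p => by
    conv_lhs => rw [hu]
    simp [simpleTensor, Finset.sum_apply, Matrix.sum_apply]
  simp only [Matrix.sum_apply, Matrix.smul_apply, smul_eq_mul, hY', Finset.sum_apply,
    simpleTensor, Matrix.of_apply, Finset.mul_sum, Finset.sum_mul]
  rw [Finset.sum_comm]
  simp only [mul_assoc]

/-- Any tensor with first slice space `W` has tensor rank `trkSpace W`. -/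
theorem trk_eq_trkSpace {k n m : ℕ} (X : Tensor3 𝕂 k n m)
    (W : Submodule 𝕂 (Matrix (Fin n) (Fin m) 𝕂)) (h : ss₁ X = W) : trk X = trkSpace W :=
  le_antisymm
    (trk_le_of_ss₁_le _ _ (by rw [h, ss₁_generatorTensor]))
    (trk_le_of_ss₁_le _ _ (by rw [h, ss₁_generatorTensor]))

/-- The matrix `Γ(v)` whose `i`-th row is the coordinate vector of `v_i` in the basis `Γ`. -/
def expand {F K : Type*} [Field F] [Field K] [Algebra F K] {n m : ℕ}
    (Γ : Module.Basis (Fin m) F K) (v : Fin n → K) : Matrix (Fin n) (Fin m) F :=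
  Matrix.of fun i j => Γ.repr (v i) j

/-- The `F`-space of matrices `Γ(V) = ⟨Γ(v) : v ∈ V⟩` of a vector code `V ≤ K^n`. -/
def expandSpace {F K : Type*} [Field F] [Field K] [Algebra F K] {n m : ℕ}
    (Γ : Module.Basis (Fin m) F K) (V : Submodule K (Fin n → K)) :
    Submodule F (Matrix (Fin n) (Fin m) F) :=
  Submodule.span F (expand Γ '' (V : Set (Fin n → K)))

/-- The tensor rank of the vector code `V ≤ K^n`, computed in the basis `Γ` of `K` over `F`. -/
def trkCode {F K : Type*} [Field F] [Field K] [Algebra F K] {n m : ℕ}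
    (Γ : Module.Basis (Fin m) F K) (V : Submodule K (Fin n → K)) : ℕ :=
  trkSpace (expandSpace Γ V)

end TensorRank

end

/-! Put `B₁`, `B₂` for the maps `F^m → K` given by the rows of `G`. Then `trkCode` is the rank over
`F` of the bilinear map `((a, b), y) ↦ a B₁(y) + b B₂(y)`, a sum of terms `u_r(x) v_r(y) w_r`. Lower
bound (`le_card_of_bilinear_decomposition`), by substitution: extract from the `v_r` the dual of a
basis `e` and find a nonzero minor on `e_i`, `e_j`. The `u_r` outside the other `m - 2` chosen
indices still separate `K × K`, so some `x ≠ 0` kills `2m - 1` of those terms. The remaining `R - 2m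
+ 1` terms, with one more functional, must separate `F^m`. Upper bound: by Cramer's rule the map is
a sum of two maps `α t(y)`, each `t` being singular. Up to scaling, the image of `t` consists of
polynomials of degree at most `m - 2`, so `exists_decomposition_of_singular` interpolates the
product at `2m - 3` points and infinity. -/

namespace TensorRank

open Module Polynomial

/-! ### Separating families of functionals -/

section Separation

variable {F V ι : Type*} [Field F] [AddCommGroup V] [Module F V] [FiniteDimensional F V]

/-- A family of functionals without common zeros contains the dual of a basis. -/
theorem exists_dual_basis_of_separating (f : ι → Dual F V) (S : Set ι)
    (hS : ∀ x, (∀ r ∈ S, f r x = 0) → x = 0) :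
    ∃ (a : Fin (finrank F V) → ι) (b : Basis (Fin (finrank F V)) F V),
      Function.Injective a ∧ (∀ i, a i ∈ S) ∧
        ∀ i x, f (a i) x = b.repr x i := by
  have hspan : Submodule.span F (f '' S) = ⊤ := by
    rw [← Subspace.dualCoannihilator_dualAnnihilator_eq (W := Submodule.span F (f '' S))]
    have : (Submodule.span F (f '' S)).dualCoannihilator = ⊥ := by
      rw [eq_bot_iff]
      intro x hx
      rw [Submodule.mem_dualCoannihilator] at hx
      exact hS x fun r hr => hx _ (Submodule.subset_span ⟨r, hr, rfl⟩)
    rw [this, Submodule.dualAnnihilator_bot]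
  have hex := Submodule.exists_fun_fin_finrank_span_eq F (f '' S)
  rw [hspan, finrank_top, Subspace.dual_finrank_eq] at hex
  obtain ⟨g, hg, hgs, hgl⟩ := hex
  choose a haS hag using hg
  let B : Basis _ F (Dual F V) := Basis.mk hgl hgs.ge
  obtain ⟨b, hb⟩ : ∃ b : Basis (Fin (finrank F V)) F V, ∀ i x, B i x = b.repr x i := by
    let e : V ≃ₗ[F] (Fin (finrank F V) → F) :=
      LinearEquiv.ofInjectiveOfFinrankEq (LinearMap.pi fun i => B i)
        (by
          rw [← LinearMap.ker_eq_bot, eq_bot_iff]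
          intro x hx
          have hx' : ∀ i, B i x = 0 := fun i => congrFun hx i
          refine (forall_dual_apply_eq_zero_iff F x).1 fun φ => ?_
          rw [← B.sum_repr φ, LinearMap.sum_apply]
          exact Finset.sum_eq_zero fun i _ => by rw [LinearMap.smul_apply, hx', smul_zero])
        (by simp)
    exact ⟨Basis.ofEquivFun e, fun i x => rfl⟩
  refine ⟨a, b, ?_, haS, fun i x => ?_⟩
  · intro i j hij
    exact hgl.injective (by rw [← hag i, ← hag j, hij])
  · rw [← hb, hag]
    simp [B]

theorem finrank_le_card_of_separating (f : ι → Dual F V) (S : Finset ι)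
    (hS : ∀ x, (∀ r ∈ S, f r x = 0) → x = 0) : finrank F V ≤ S.card := by
  obtain ⟨a, b, ha, haS, -⟩ := exists_dual_basis_of_separating f S hS
  simpa using Finset.card_le_card_of_injOn (s := Finset.univ) a (fun i _ => haS i) ha.injOn

end Separation

/-! ### The lower bound for bilinear rank -/

section Bilinear

variable {F K Y : Type*} [Field F] [Field K] [Algebra F K]
  [AddCommGroup Y] [Module F Y]

/-- Two `F`-linear maps into `K` that are not proportional over `K` have a nonzero `2 × 2` minor on
any given basis. -/
theorem exists_det_ne_zero {κ : Type*} (b : Basis κ F Y) (B₁ B₂ : Y →ₗ[F] K)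
    (hB₁ : Function.Injective B₁) (hB : ∀ c : K, ∃ y, B₂ y ≠ c * B₁ y) :
    ∃ i j, B₁ (b i) * B₂ (b j) - B₁ (b j) * B₂ (b i) ≠ 0 := by
  by_contra! h
  obtain ⟨y, hy⟩ := hB 0
  have hne : Nonempty κ := by
    by_contra hκ
    rw [not_nonempty_iff] at hκ
    have : y = 0 := b.repr.injective (Subsingleton.elim _ _)
    simp [this] at hy
  obtain ⟨i⟩ := hne
  have hi : B₁ (b i) ≠ 0 := fun h0 => b.ne_zero i (hB₁ (by simpa using h0))
  obtain ⟨z, hz⟩ := hB (B₂ (b i) / B₁ (b i))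
  apply hz
  -- The vanishing minors with `i` fixed already force proportionality on the whole basis.
  have : B₂ = (LinearMap.mulLeft F (B₂ (b i) / B₁ (b i))) ∘ₗ B₁ := by
    refine b.ext fun j => ?_
    simp only [LinearMap.comp_apply, LinearMap.mulLeft_apply]
    field_simp
    linear_combination h i j
  exact congrArg (fun g : Y →ₗ[F] K => g z) this

/-- Lower bound for the rank of the bilinear map `((a, b), y) ↦ a B₁(y) + b B₂(y)`. -/
theorem le_card_of_bilinear_decomposition [FiniteDimensional F K] [FiniteDimensional F Y]
    {ι : Type*} [Fintype ι] (B₁ B₂ : Y →ₗ[F] K)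
    (hB₁ : Function.Injective B₁) (hB : ∀ c : K, ∃ y, B₂ y ≠ c * B₁ y)
    (u : ι → Dual F (K × K)) (v : ι → Dual F Y) (w : ι → K)
    (h : ∀ x y, x.1 * B₁ y + x.2 * B₂ y = ∑ r, (u r x * v r y) • w r) :
    finrank F Y + 2 * finrank F K ≤ Fintype.card ι + 2 := by
  classical
  obtain ⟨p, e, hp, -, hpe⟩ := exists_dual_basis_of_separating v Set.univ (fun y hy => by
    apply hB₁
    simpa [hy] using h (1, 0) y)
  obtain ⟨i, j, hij⟩ := exists_det_ne_zero e B₁ B₂ hB₁ hB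
  have hne : i ≠ j := by rintro rfl; simp at hij
  have hker : ∀ x : K × K, x.1 * B₁ (e i) + x.2 * B₂ (e i) = 0 →
      x.1 * B₁ (e j) + x.2 * B₂ (e j) = 0 → x = 0 := by
    rintro ⟨a, b⟩ h₁ h₂
    simp only at h₁ h₂
    have ha : a = 0 := (mul_eq_zero_iff_right hij).1 (by
      linear_combination B₂ (e j) * h₁ - B₂ (e i) * h₂)
    have hb : b = 0 := (mul_eq_zero_iff_right hij).1 (by
      linear_combination B₁ (e i) * h₂ - B₁ (e j) * h₁)
    rw [ha, hb]; rfl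
  -- These `m - 2` terms vanish at both `e i` and `e j`, whose values determine `x`; hence the `u r`
  -- with `r ∉ Z` separate.
  let Z : Set ι := {r | ∃ k, k ≠ i ∧ k ≠ j ∧ p k = r}
  have hZ : ∀ k, k = i ∨ k = j → ∀ r ∈ Z, v r (e k) = 0 := by
    rintro k hk _ ⟨l, hli, hlj, rfl⟩
    rw [hpe, e.repr_self, Finsupp.single_apply, if_neg]
    rintro rfl
    exact hk.elim hli hlj
  obtain ⟨s, d, hs, hsZ, hsd⟩ := exists_dual_basis_of_separating u Zᶜ (fun x hx => by
    have : ∀ k, k = i ∨ k = j → x.1 * B₁ (e k) + x.2 * B₂ (e k) = 0 := fun k hk => by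
      rw [h]
      refine Finset.sum_eq_zero fun r _ => ?_
      by_cases hr : r ∈ Z
      · simp [hZ k hk r hr]
      · simp [hx r hr]
    exact hker x (this i (.inl rfl)) (this j (.inr rfl)))
  have hdim : finrank F (K × K) = 2 * finrank F K := by rw [finrank_prod]; ring
  have hpos : 0 < finrank F (K × K) := by
    rw [hdim]; have : 0 < finrank F K := finrank_pos
    omega
  let l : Fin (finrank F (K × K)) := ⟨0, hpos⟩
  -- Only terms in `T` can survive at `x = d l`. Since `s` avoids `Z`, `T` contains `Z`.
  let T : Finset ι := ((Finset.univ.erase l).image s)ᶜ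
  have hT : ∀ r ∉ T, u r (d l) = 0 := by
    intro r hr
    simp only [T, Finset.mem_compl, not_not, Finset.mem_image, Finset.mem_erase] at hr
    obtain ⟨k, ⟨hk, -⟩, rfl⟩ := hr
    rw [hsd, d.repr_self, Finsupp.single_apply, if_neg hk.symm]
  have hZT : ∀ r ∈ Z, r ∈ T := by
    intro r hr
    simp only [T, Finset.mem_compl, Finset.mem_image, not_exists, not_and]
    rintro k - rfl
    exact hsZ k hr
  have hTcard : T.card + (finrank F (K × K) - 1) = Fintype.card ι := by
    have h1 := Finset.card_compl_add_card ((Finset.univ.erase l).image s)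
    rwa [Finset.card_image_of_injective _ hs, Finset.card_erase_of_mem (Finset.mem_univ _),
      Finset.card_univ, Fintype.card_fin] at h1
  -- Adding `p k'` to `T ⊇ Z` confines a common zero `y` to the line of `e k`, on which the map at
  -- `d l` is injective.
  have key : ∀ k k', (k = i ∧ k' = j ∨ k = j ∧ k' = i) →
      (d l).1 * B₁ (e k) + (d l).2 * B₂ (e k) ≠ 0 → finrank F Y ≤ T.card + 1 := by
    intro k k' hk hnz
    refine (finrank_le_card_of_separating v (insert (p k') T) fun y hy => ?_).trans
      (Finset.card_insert_le _ _)
    have hy0 : (d l).1 * B₁ y + (d l).2 * B₂ y = 0 := by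
      rw [h]
      refine Finset.sum_eq_zero fun r _ => ?_
      by_cases hr : r ∈ T
      · simp [hy r (Finset.mem_insert_of_mem hr)]
      · simp [hT r hr]
    have hyk : y = e.repr y k • e k := by
      conv_lhs => rw [← e.sum_repr y]
      refine Finset.sum_eq_single k (fun n _ hn => ?_) (by simp)
      rw [← hpe]
      by_cases hn' : n = k'
      · rw [hn', hy _ (Finset.mem_insert_self _ _), zero_smul]
      · rw [hy _ (Finset.mem_insert_of_mem (hZT _ ⟨n, ?_, ?_, rfl⟩)), zero_smul]
        · rcases hk with ⟨rfl, rfl⟩ | ⟨rfl, rfl⟩ <;> assumption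
        · rcases hk with ⟨rfl, rfl⟩ | ⟨rfl, rfl⟩ <;> assumption
    rw [hyk] at hy0 ⊢
    rw [map_smul, map_smul, mul_smul_comm, mul_smul_comm, ← smul_add] at hy0
    rcases smul_eq_zero.1 hy0 with h0 | h0
    · rw [h0, zero_smul]
    · exact absurd h0 hnz
  have hY : finrank F Y ≤ T.card + 1 := by
    by_cases h0 : (d l).1 * B₁ (e i) + (d l).2 * B₂ (e i) = 0
    · exact key j i (.inr ⟨rfl, rfl⟩) fun h1 => d.ne_zero l (hker _ h0 h1)
    · exact key i j (.inl ⟨rfl, rfl⟩) h0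
  omega

end Bilinear

/-! ### Polynomial multiplication by interpolation -/

section Interpolation
variable {F K : Type*} [Field F] [Field K] [Algebra F K]

open scoped Classical in
/-- Interpolation at the points of `s` and at infinity. -/
theorem mul_eq_interpolate_add_nodal (s : Finset F) (k l : ℕ) (hs : s.card = k + l) {f g : F[X]}
    (hf : f.natDegree ≤ k) (hg : g.natDegree ≤ l) :
    f * g = ∑ x ∈ s, C (f.eval x * g.eval x) * Lagrange.basis s id x +
      C (f.coeff k * g.coeff l) * Lagrange.nodal s id := by
  have hN : (Lagrange.nodal s (id : F → F)).natDegree = k + l := by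
    rw [Lagrange.natDegree_nodal, hs]
  have hNm : (Lagrange.nodal s (id : F → F)).Monic := Lagrange.nodal_monic
  -- The value at infinity is the coefficient of degree `k + l`; the monic nodal polynomial removes
  -- it.
  have hdeg : (f * g - C (f.coeff k * g.coeff l) * Lagrange.nodal s id).degree < s.card := by
    rw [hs, degree_lt_iff_coeff_zero]
    intro n hn
    rcases hn.eq_or_lt with rfl | hn
    · rw [coeff_sub, coeff_mul_add_eq_of_natDegree_le hf hg, coeff_C_mul, ← hN, hNm.coeff_natDegree]
      simp
    · rw [coeff_sub, coeff_C_mul, coeff_eq_zero_of_natDegree_lt,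
        coeff_eq_zero_of_natDegree_lt (hN.trans_lt hn)]
      · simp
      · exact (natDegree_mul_le.trans (add_le_add hf hg)).trans_lt hn
  have h := Lagrange.eq_interpolate (v := id) Function.injective_id.injOn hdeg
  rw [Lagrange.interpolate_apply] at h
  rw [← sub_eq_iff_eq_add, h]
  refine Finset.sum_congr rfl fun x hx => ?_
  have : (Lagrange.nodal s (id : F → F)).eval x = 0 :=
    Lagrange.eval_nodal_at_node (v := id) hx
  simp [this]

/-- The polynomial of degree less than `pb.dim` representing an element. -/
noncomputable def powerPoly (pb : PowerBasis F K) : K →ₗ[F] F[X] :=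
  ∑ i : Fin pb.dim, monomial (i : ℕ) ∘ₗ pb.basis.coord i

theorem powerPoly_apply (pb : PowerBasis F K) (z : K) :
    powerPoly pb z = ∑ i : Fin pb.dim, monomial (i : ℕ) (pb.basis.repr z i) := by
  simp [powerPoly]

theorem aeval_powerPoly (pb : PowerBasis F K) (z : K) : aeval pb.gen (powerPoly pb z) = z := by
  conv_rhs => rw [← pb.basis.sum_repr z]
  simp [powerPoly_apply, aeval_monomial, Algebra.smul_def]

theorem coeff_powerPoly_of_le (pb : PowerBasis F K) (z : K) {n : ℕ} (hn : pb.dim ≤ n) :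
    (powerPoly pb z).coeff n = 0 := by
  rw [powerPoly_apply, finsetSum_coeff]
  refine Finset.sum_eq_zero fun i _ => ?_
  rw [coeff_monomial, if_neg]
  omega

/-- Any functional on `K` is a multiple of the top coordinate of a power basis. -/
theorem exists_coeff_mul_eq [FiniteDimensional F K] (pb : PowerBasis F K) (φ : Dual F K) :
    ∃ c : K, ∀ z, φ z = (powerPoly pb (c * z)).coeff (pb.dim - 1) := by
  let ψ : Dual F K := lcoeff F (pb.dim - 1) ∘ₗ powerPoly pb
  let Φ : K →ₗ[F] Dual F K := (LinearMap.mul F K).compr₂ ψ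
  have hψ : ψ ≠ 0 := by
    intro h0
    have hpos := pb.dim_pos
    have h1 : ψ (pb.basis ⟨pb.dim - 1, by omega⟩) = 0 := by rw [h0]; rfl
    simp only [ψ, LinearMap.comp_apply, powerPoly_apply, Basis.repr_self, lcoeff_apply,
      finsetSum_coeff, coeff_monomial] at h1
    rw [Finset.sum_eq_single ⟨pb.dim - 1, by omega⟩] at h1
    · simp at h1
    · intro i _ hi
      rw [Finsupp.single_apply, if_neg hi.symm]
      simp
    · simp
  -- As `ψ ≠ 0`, the form `(c, z) ↦ ψ (c * z)` is nondegenerate; surjectivity follows by dimension.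
  have hinj : Function.Injective Φ := by
    rw [← LinearMap.ker_eq_bot, eq_bot_iff]
    intro c hc
    by_contra hc0
    apply hψ
    ext z
    have := LinearMap.congr_fun hc (c⁻¹ * z)
    have hc0' : c ≠ 0 := hc0
    simpa [Φ, mul_inv_cancel_left₀ hc0'] using this
  have hsurj : Function.Surjective Φ :=
    (LinearMap.injective_iff_surjective_of_finrank_eq_finrank
      (Subspace.dual_finrank_eq).symm).1 hinj
  obtain ⟨c, hc⟩ := hsurj φ
  exact ⟨c, fun z => by rw [← hc]; rfl⟩

open scoped Classical in
/-- The bilinear map `(a, y) ↦ a t(y)` has rank at most `2m - 2` when the image of `t` lies in a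
hyperplane. -/
theorem exists_decomposition_of_singular {Y : Type*} [AddCommGroup Y] [Module F Y]
    [FiniteDimensional F K] (pb : PowerBasis F K) (n : ℕ) (hn : pb.dim = n + 2) (s : Finset F)
    (hs : s.card = 2 * n + 1) (t : Y →ₗ[F] K) (ht : LinearMap.range t ≠ ⊤) :
    ∃ (v : Option s → Dual F Y) (w : Option s → K), ∀ a : K, ∃ c : Option s → F,
      ∀ y, a * t y = ∑ r, (c r * v r y) • w r := by
  obtain ⟨φ, hφ, hφt⟩ := Submodule.exists_dual_map_eq_bot_of_lt_top (lt_top_iff_ne_top.2 ht)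
    inferInstance
  obtain ⟨c, hc⟩ := exists_coeff_mul_eq pb φ
  have hc0 : c ≠ 0 := by
    rintro rfl
    exact hφ (LinearMap.ext fun z => by simp [hc])
  -- Multiplication by `c` moves the hyperplane `φ = 0` to the elements with zero top coordinate,
  -- saving one degree.
  let g : Y →ₗ[F] F[X] := powerPoly pb ∘ₗ LinearMap.mulLeft F c ∘ₗ t
  have hg : ∀ y, (g y).natDegree ≤ n := by
    intro y
    rw [natDegree_le_iff_coeff_eq_zero]
    intro N hN
    rcases (Nat.succ_le_of_lt hN).eq_or_lt with rfl | hN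
    · have h1 : φ (t y) ∈ Submodule.map φ (LinearMap.range t) :=
        Submodule.mem_map_of_mem (LinearMap.mem_range_self t y)
      rw [hφt, Submodule.mem_bot, hc, hn] at h1
      exact h1
    · exact coeff_powerPoly_of_le pb _ (by omega)
  -- The index `none` is the point at infinity.
  refine ⟨fun r => r.elim (lcoeff F n ∘ₗ g) fun x => leval (x : F) ∘ₗ g,
    fun r => r.elim (c⁻¹ * aeval pb.gen (Lagrange.nodal s (id : F → F)))
      fun x => c⁻¹ * aeval pb.gen (Lagrange.basis s id (x : F)), fun a => ?_⟩
  refine ⟨fun r => r.elim ((powerPoly pb a).coeff (n + 1)) fun x => (powerPoly pb a).eval (x : F),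
    fun y => ?_⟩
  have hf : (powerPoly pb a).natDegree ≤ n + 1 := by
    rw [natDegree_le_iff_coeff_eq_zero]
    exact fun N hN => coeff_powerPoly_of_le pb _ (by omega)
  have h := congrArg (aeval pb.gen) (mul_eq_interpolate_add_nodal s (n + 1) n (by omega) hf (hg y))
  have hgy : aeval pb.gen (g y) = c * t y := aeval_powerPoly pb _
  rw [map_mul, aeval_powerPoly, hgy] at h
  have h' : a * t y = c⁻¹ * (a * (c * t y)) := by field_simp
  rw [h', h, ← Finset.sum_coe_sort]
  simp only [map_add, map_sum, map_mul, aeval_C, Fintype.sum_option, Option.elim, mul_add,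
    Finset.mul_sum, Algebra.smul_def, LinearMap.comp_apply, lcoeff_apply, leval_apply]
  rw [add_comm]
  congr 1
  · ring
  · exact Finset.sum_congr rfl fun x _ => by ring

end Interpolation

/-! ### From matrix spaces to bilinear maps and back -/

section Matrices

variable {F : Type*} [Field F] {n m : ℕ}

theorem trkSpace_le_of_le_span {ι : Type*} [Fintype ι] (W : Submodule F (Matrix (Fin n) (Fin m) F))
    (v : ι → Fin n → F) (w : ι → Fin m → F)
    (h : W ≤ Submodule.span F (Set.range fun r => Matrix.vecMulVec (v r) (w r))) :
    trkSpace W ≤ Fintype.card ι := by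
  let e := Fintype.equivFin ι
  let T : Tensor3 F (Fintype.card ι) n m :=
    fun r => Matrix.vecMulVec (v (e.symm r)) (w (e.symm r))
  have hX : trk T ≤ Fintype.card ι := by
    refine Nat.sInf_le ⟨fun r => Pi.single r 1, v ∘ e.symm, w ∘ e.symm, ?_⟩
    funext l
    ext i j
    simp [T, simpleTensor, Finset.sum_apply, Matrix.sum_apply, Pi.single_apply,
      Matrix.vecMulVec_apply]
  refine (trk_le_of_ss₁_le (generatorTensor W) T ?_).trans hX
  rw [ss₁_generatorTensor]
  refine h.trans (Submodule.span_mono ?_)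
  rintro _ ⟨r, rfl⟩
  exact ⟨e r, by simp [T]⟩

theorem exists_le_span_trkSpace (W : Submodule F (Matrix (Fin n) (Fin m) F)) :
    ∃ (v : Fin (trkSpace W) → Fin n → F) (w : Fin (trkSpace W) → Fin m → F),
      W ≤ Submodule.span F (Set.range fun r => Matrix.vecMulVec (v r) (w r)) := by
  obtain ⟨u, v, w, h⟩ : IsSumOfSimple (generatorTensor W) (trkSpace W) :=
    Nat.sInf_mem (exists_isSumOfSimple _)
  refine ⟨v, w, ?_⟩
  conv_lhs => rw [← ss₁_generatorTensor W]
  rw [ss₁, Submodule.span_le]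
  rintro _ ⟨l, rfl⟩
  have : generatorTensor W l = ∑ r, u r l • Matrix.vecMulVec (v r) (w r) := by
    conv_lhs => rw [h]
    ext i j
    simp [simpleTensor, Finset.sum_apply, Matrix.sum_apply, Matrix.vecMulVec_apply, mul_assoc]
  rw [this]
  exact Submodule.sum_mem _ fun r _ => Submodule.smul_mem _ _ (Submodule.subset_span ⟨r, rfl⟩)

variable {K : Type*} [Field K] [Algebra F K]

/-- Dictionary between rank-one expansions of matrices and decompositions with values in `K`. -/
theorem expand_eq_sum_iff (Γ : Basis (Fin m) F K) {ι : Type*} [Fintype ι] (z : Fin n → K)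
    (c : ι → F) (v : ι → Fin n → F) (w : ι → Fin m → F) :
    expand Γ z = ∑ r, c r • Matrix.vecMulVec (v r) (w r) ↔
      ∀ i, z i = ∑ r, (c r * v r i) • Γ.equivFun.symm (w r) := by
  rw [← Matrix.ext_iff]
  refine forall_congr' fun i => ?_
  rw [← Γ.equivFun.injective.eq_iff, funext_iff]
  refine forall_congr' fun j => ?_
  simp only [map_sum, map_smul, LinearEquiv.apply_symm_apply, Finset.sum_apply, Pi.smul_apply,
    smul_eq_mul, Matrix.sum_apply, Matrix.smul_apply, Matrix.vecMulVec_apply, mul_assoc]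
  rfl

theorem expand_add (Γ : Basis (Fin m) F K) (z z' : Fin n → K) :
    expand Γ (z + z') = expand Γ z + expand Γ z' := by
  ext i j; simp [expand]

theorem expand_smul (Γ : Basis (Fin m) F K) (c : F) (z : Fin n → K) :
    expand Γ (c • z) = c • expand Γ z := by
  ext i j; simp [expand]

/-- The matrices of a two-dimensional code, as a linear function of the two coefficients. -/
noncomputable def expandPair (Γ : Basis (Fin m) F K) (g₀ g₁ : Fin n → K) :
    (K × K) →ₗ[F] Matrix (Fin n) (Fin m) F where
  toFun x := expand Γ (x.1 • g₀ + x.2 • g₁)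
  map_add' x y := by
    rw [← expand_add]; congr 1; simp only [Prod.fst_add, Prod.snd_add, add_smul]; abel
  map_smul' c x := by
    rw [RingHom.id_apply, ← expand_smul]; congr 1
    simp only [Prod.smul_fst, Prod.smul_snd, smul_add, smul_assoc]

theorem exists_dual_of_range_le_span {U M ι : Type*} [AddCommGroup U] [Module F U]
    [AddCommGroup M] [Module F M] [Fintype ι] (φ : U →ₗ[F] M) (E : ι → M)
    (h : LinearMap.range φ ≤ Submodule.span F (Set.range E)) :
    ∃ u : ι → Dual F U, ∀ x, φ x = ∑ r, u r x • E r := by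
  classical
  let b := Basis.ofVectorSpace F U
  have hc : ∀ k, ∃ c : ι → F, ∑ r, c r • E r = φ (b k) := fun k =>
    (Submodule.mem_span_range_iff_exists_fun F).1 (h (LinearMap.mem_range_self φ _))
  choose c hc using hc
  refine ⟨fun r => b.constr F fun k => c k r, fun x => ?_⟩
  have : φ = ∑ r, (b.constr F fun k => c k r).smulRight (E r) :=
    b.ext fun k => by simp [← hc]
  conv_lhs => rw [this]
  simp

variable {G : Matrix (Fin 2) (Fin m) K}

theorem linearCombination_injective_and_not_proportional
    (hrow : ∀ i : Fin 2, LinearIndependent F (fun j : Fin m => G i j))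
    (hrank : LinearIndependent K G.row) :
    Function.Injective (Fintype.linearCombination F (G 0)) ∧
      ∀ c : K, ∃ y, Fintype.linearCombination F (G 1) y ≠
        c * Fintype.linearCombination F (G 0) y := by
  classical
  refine ⟨(hrow 0).fintypeLinearCombination_injective, fun c => ?_⟩
  by_contra! h
  have h0 : c • G.row 0 + (-1 : K) • G.row 1 = 0 := by
    funext j
    have := h (Pi.single j 1)
    simp only [Fintype.linearCombination_apply_single, one_smul] at this
    simp [this, Matrix.row]
  have hs := Fintype.linearIndependent_iff.1 hrank ![c, -1] (by simpa [Fin.sum_univ_two] using h0) 1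
  simp at hs

theorem le_trkCode [FiniteDimensional F K] (hm : finrank F K = m)
    (hrow : ∀ i : Fin 2, LinearIndependent F (fun j : Fin m => G i j))
    (hrank : LinearIndependent K G.row) (Γ : Basis (Fin m) F K) :
    3 * m - 2 ≤ trkCode Γ (Submodule.span K (Set.range G.row)) := by
  obtain ⟨hinj, hprop⟩ := linearCombination_injective_and_not_proportional hrow hrank
  obtain ⟨v, w, hvw⟩ := exists_le_span_trkSpace
    (expandSpace Γ (Submodule.span K (Set.range G.row)))
  obtain ⟨u, hu⟩ := exists_dual_of_range_le_span (expandPair Γ (G 0) (G 1)) _ (le_trans (by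
    rintro _ ⟨x, rfl⟩
    refine Submodule.subset_span ⟨_, Submodule.add_mem _ ?_ ?_, rfl⟩
    · exact Submodule.smul_mem _ _ (Submodule.subset_span ⟨0, rfl⟩)
    · exact Submodule.smul_mem _ _ (Submodule.subset_span ⟨1, rfl⟩)) hvw)
  have h := le_card_of_bilinear_decomposition _ _ hinj hprop u
    (fun r => Fintype.linearCombination F (v r)) (fun r => Γ.equivFun.symm (w r)) (by
      intro x y
      have hx := (expand_eq_sum_iff Γ _ _ v w).1 (hu x)
      simp only [Fintype.linearCombination_apply, Finset.mul_sum, ← Finset.sum_add_distrib,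
        Finset.sum_smul]
      rw [Finset.sum_comm]
      refine Finset.sum_congr rfl fun i _ => ?_
      rw [mul_smul_comm, mul_smul_comm, ← smul_add]
      refine (congrArg (y i • ·) (hx i)).trans ?_
      simp only [Finset.smul_sum, smul_smul, smul_eq_mul]
      exact Finset.sum_congr rfl fun r _ => by congr 1; ring)
  rw [finrank_fin_fun, hm, Fintype.card_fin] at h
  change 3 * m - 2 ≤ trkSpace _
  omega

theorem trkCode_le [Finite F] [FiniteDimensional F K] (hm2 : 2 ≤ m)
    (hm : finrank F K = m) (hq : 2 * m - 3 ≤ Nat.card F)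
    (hrow : ∀ i : Fin 2, LinearIndependent F (fun j : Fin m => G i j))
    (hrank : LinearIndependent K G.row) (Γ : Basis (Fin m) F K) :
    trkCode Γ (Submodule.span K (Set.range G.row)) ≤ 4 * m - 4 := by
  classical
  obtain ⟨hinj, hprop⟩ := linearCombination_injective_and_not_proportional hrow hrank
  obtain ⟨i, j, hij⟩ := exists_det_ne_zero (Pi.basisFun F (Fin m)) _ _ hinj hprop
  simp only [Pi.basisFun_apply, Fintype.linearCombination_apply_single, one_smul] at hij
  obtain ⟨n, rfl⟩ := Nat.exists_eq_add_of_le' hm2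
  have := Fintype.ofFinite F
  obtain ⟨s, -, hs⟩ := Finset.exists_subset_card_eq (s := (Finset.univ : Finset F))
    (n := 2 * n + 1) (by rw [Finset.card_univ, ← Nat.card_eq_fintype_card]; omega)
  let pb := Field.powerBasisOfFiniteOfSeparable F K
  have hpb : pb.dim = n + 2 := by rw [← pb.finrank, hm]
  -- `t k` is the minor of column `k` against the combination `y` of columns; it kills the `k`-th
  -- unit vector, so it is singular.
  let t (k : Fin (n + 2)) : (Fin (n + 2) → F) →ₗ[F] K :=
    LinearMap.mulLeft F (G 0 k) ∘ₗ Fintype.linearCombination F (G 1) -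
      LinearMap.mulLeft F (G 1 k) ∘ₗ Fintype.linearCombination F (G 0)
  have ht : ∀ k, LinearMap.range (t k) ≠ ⊤ := by
    intro k hk
    have hi : Function.Injective (t k) :=
      (LinearMap.injective_iff_surjective_of_finrank_eq_finrank (by rw [finrank_fin_fun, hm])).2
        (LinearMap.range_eq_top.1 hk)
    have h0 : (Pi.single k 1 : Fin (n + 2) → F) = 0 := hi (by simp [t, mul_comm])
    simpa using congrFun h0 k
  obtain ⟨v₀, w₀, h₀⟩ := exists_decomposition_of_singular pb n hpb s hs (t i) (ht i)
  obtain ⟨v₁, w₁, h₁⟩ := exists_decomposition_of_singular pb n hpb s hs (t j) (ht j)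
  have hle := trkSpace_le_of_le_span (expandSpace Γ (Submodule.span K (Set.range G.row)))
    (fun (r : Option s ⊕ Option s) k => Sum.elim v₀ v₁ r (Pi.single k 1))
    (fun r => Γ.equivFun (Sum.elim w₀ w₁ r)) (by
      rw [expandSpace, Submodule.span_le]
      rintro _ ⟨z, hz, rfl⟩
      obtain ⟨c, rfl⟩ := (Submodule.mem_span_range_iff_exists_fun K).1 hz
      -- Cramer's rule: a codeword `z` satisfies `D z_k = z_j t_i(e_k) - z_i t_j(e_k)`, which
      -- dictates the two multipliers.
      set D := G 0 i * G 1 j - G 0 j * G 1 i with hD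
      obtain ⟨c₀, hc₀⟩ := h₀ ((c 1 * G 1 j + c 0 * G 0 j) / D)
      obtain ⟨c₁, hc₁⟩ := h₁ (-(c 1 * G 1 i + c 0 * G 0 i) / D)
      refine (Submodule.mem_span_range_iff_exists_fun F).2 ⟨Sum.elim c₀ c₁, Eq.symm ?_⟩
      refine (expand_eq_sum_iff Γ _ _ _ _).2 fun k => ?_
      simp only [Fintype.sum_sum_type, Sum.elim_inl, Sum.elim_inr,
        LinearEquiv.symm_apply_apply]
      rw [← hc₀, ← hc₁]
      simp only [t, LinearMap.sub_apply, LinearMap.comp_apply, LinearMap.mulLeft_apply,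
        Fintype.linearCombination_apply_single, one_smul, Fin.sum_univ_two, Pi.add_apply,
        Pi.smul_apply, smul_eq_mul, Matrix.row]
      field_simp
      rw [hD]
      ring)
  refine hle.trans ?_
  simp only [Fintype.card_sum, Fintype.card_option, Fintype.card_coe, hs]
  omega

end Matrices

end TensorRank

theorem mainTheorem9 {F K : Type*} [Field F] [Finite F] [Field K] [Algebra F K]
    (q m : ℕ) (hm2 : 2 ≤ m) (hq : Nat.card F = q) (hm : Module.finrank F K = m)
    (hqm : 2 * m - 3 ≤ q)
    (G : Matrix (Fin 2) (Fin m) K)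
    (hrow : ∀ i : Fin 2, LinearIndependent F (fun j : Fin m => G i j))
    (hrank : LinearIndependent K G.row)
    (V : Submodule K (Fin m → K)) (hV : V = Submodule.span K (Set.range G.row))
    (Γ : Module.Basis (Fin m) F K) :
    3 * m - 2 ≤ TensorRank.trkCode Γ V ∧ TensorRank.trkCode Γ V ≤ 4 * m - 4 := by
  subst hV hq
  have := Module.Finite.of_basis Γ
  exact ⟨TensorRank.le_trkCode hm hrow hrank Γ, TensorRank.trkCode_le hm2 hm hqm hrow hrank Γ⟩
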